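/- Let $X$ be a real random variable with law $ID(b,0,\nu)$, i.e. with characteristic function $$\varphi(t)=\exp\Big(itb+\int_{-\infty}^{+\infty}\big(e^{itu}-1-itu\,\mathbf 1_{|u|\le 1}\big)\,\nu(du)\Big),\qquad t\in\mathbb R,$$ where $b\in\mathbb R$ and $\nu$ is a positive Borel measure on $\mathbb R$ with $\nu(\{0\})=0$ and $\int(1\wedge u^2)\,\nu(du)<\infty$. Assume that $\mathbb E|X|<\infty$, that $\int_{-1}^{1}|u|\,\nu(du)<\infty$, that the law of $X$ is absolutely continuous with respect to Lebesgue measure with a bounded density $h$ (in particular $X$ is nondegenerate), and that for some $C>0$ and $p\ge 1$, $$|\varphi(t)|\int_0^{|t|}\frac{ds}{|\varphi(s)|}\le C|t|^p\qquad\text{for all }t\in\mathbb R.$$ Let $b_0=b-\int_{|u|\le 1}u\,\nu(du)$ be the drift of $X$. For $n\ge 1$ let $X_n$ be a compound Poisson random variable with characteristic function $$\varphi_n(t)=\exp\big(n\,(\varphi(t)^{1/n}-1)\big),\qquad t\in\mathbb R,$$ where $\varphi^{1/n}$ is the continuous $n$-th root of $\varphi$ on $\mathbb R$ with value $1$ at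 $0$. Then $\int_{-\infty}^{+\infty}|u|\,\nu(du)<\infty$ and, for every $n\ge 1$, $$d_K(X_n,X):=\sup_{x\in\mathbb R}\big|\mathbb P(X_n\le x)-\mathbb P(X\le x)\big|\le C'\Big(\frac1n\Big)^{\frac1{p+2}}\Big(|b_0|+\int_{-\infty}^{+\infty}|u|\,\nu(du)\Big)^{\frac2{p+2}},$$ where $C'>0$ depends only on $C$, $p$ and (an upper bound for) $\|h\|_\infty$. -/

import Mathlib

open MeasureTheory ProbabilityTheory

/-- `ν` is a Lévy measure on `ℝ`: `ν {0} = 0` and `∫ (1 ∧ u²) ν(du) < ∞`. -/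
structure IsLevyMeasure (ν : Measure ℝ) : Prop where
  measure_zero : ν {0} = 0
  lintegral_lt_top : ∫⁻ u, ENNReal.ofReal (min 1 (u ^ 2)) ∂ν < ⊤

/-- The Lévy–Khintchine exponent
`itb - σ² t² / 2 + ∫ (e^{itu} - 1 - i t u 1_{|u| ≤ 1}) ν(du)`; the argument `v` is `σ²`. -/
noncomputable def levyKhintchineExponent (b v : ℝ) (ν : Measure ℝ) (t : ℝ) : ℂ :=
  Complex.I * t * b - v * (t : ℂ) ^ 2 / 2
    + ∫ u : ℝ, (Complex.exp (Complex.I * t * u) - 1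
        - (Set.Icc (-1 : ℝ) 1).indicator (fun w : ℝ => Complex.I * (t : ℂ) * (w : ℂ)) u) ∂ν

/-- The probability measure `μ` on `ℝ` is the infinitely divisible law `ID(b, v, ν)`, where `v`
is the Gaussian variance `σ²`. -/
structure IsIDLaw (μ : Measure ℝ) (b v : ℝ) (ν : Measure ℝ) : Prop where
  isProbabilityMeasure : IsProbabilityMeasure μ
  variance_nonneg : 0 ≤ v
  isLevyMeasure : IsLevyMeasure ν
  charFun_eq : ∀ t : ℝ, charFun μ t = Complex.exp (levyKhintchineExponent b v ν t)

/-- The drift `b₀ = b - ∫_{|u| ≤ 1} u ν(du)`. -/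
noncomputable def levyDrift (b : ℝ) (ν : Measure ℝ) : ℝ :=
  b - ∫ u in Set.Icc (-1 : ℝ) 1, u ∂ν

/-- `g` is the function `φ^{1/n}`, for a continuous nowhere vanishing `φ : ℝ → ℂ` with `φ 0 = 1`
and `n ≥ 1`: the (unique) continuous `n`-th root of `φ` on the line with value `1` at `0`. It is
in general not the pointwise principal root. -/
structure IsDistinguishedRoot (φ : ℝ → ℂ) (n : ℕ) (g : ℝ → ℂ) : Prop where
  continuous : Continuous g
  map_zero : g 0 = 1
  pow_eq : ∀ t, g t ^ n = φ t

/-- The Kolmogorov distance `sup_x |μ (-∞, x] - μ' (-∞, x]|` between two laws on `ℝ`. -/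
noncomputable def kolmogorovDist (μ μ' : Measure ℝ) : ℝ :=
  ⨆ x : ℝ, |μ.real (Set.Iic x) - μ'.real (Set.Iic x)|

lemma gaussianPDFReal_eq_integral_exp {v : NNReal} (hv : v ≠ 0) (z : ℝ) :
    (gaussianPDFReal 0 v z : ℂ) = (1 / (2 * Real.pi) : ℝ) *
      ∫ t : ℝ, Complex.exp (t * z * Complex.I) * Complex.exp (-(v / 2 : ℂ) * t ^ 2) := by
  have hv0 : (0 : ℝ) < v := by positivity
  have h := fourierIntegral_gaussian (b := (v / 2 : ℂ)) (by simpa using hv0) (z : ℂ)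
  have e : (fun t : ℝ => Complex.exp (t * z * Complex.I) * Complex.exp (-(v / 2 : ℂ) * t ^ 2))
      = fun t : ℝ => Complex.exp (Complex.I * z * t) * Complex.exp (-(v / 2 : ℂ) * t ^ 2) := by
    funext t; congr 2; ring
  rw [e, h]
  have e2 : ((Real.pi : ℂ) / (v / 2 : ℂ)) ^ (1 / 2 : ℂ)
      = ((Real.sqrt (Real.pi / (v / 2)) : ℝ) : ℂ) := by
    rw [Real.sqrt_eq_rpow, Complex.ofReal_cpow (by positivity)]; push_cast; rfl
  have e3 : Complex.exp (-(z : ℂ) ^ 2 / (4 * (v / 2 : ℂ)))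
      = ((Real.exp (-z ^ 2 / (4 * (v / 2))) : ℝ) : ℂ) := by push_cast; rfl
  rw [e2, e3, gaussianPDFReal, ← Complex.ofReal_mul, ← Complex.ofReal_mul]
  congr 1
  rw [← mul_assoc]
  congr 1
  · rw [show Real.pi / (v / 2 : ℝ) = (2 * Real.pi) ^ 2 / (2 * Real.pi * v) by
      field_simp,
      Real.sqrt_div (by positivity), Real.sqrt_sq (by positivity)]
    have : Real.sqrt (2 * Real.pi * v) ≠ 0 := by positivity
    field_simp
  · congr 1; field_simp; ring

lemma integrable_exp_neg_half_mul_sq {v : NNReal} (hv : v ≠ 0) :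
    Integrable (fun t : ℝ => Complex.exp (-(v / 2 : ℂ) * t ^ 2)) := by
  have hv0 : (0 : ℝ) < v := by positivity
  simpa using integrable_cexp_quadratic (b := (v / 2 : ℂ)) (by simpa using hv0) 0 0

/-- Parseval's relation between a finite measure and a centred Gaussian density. -/
lemma integral_gaussianPDFReal_eq_integral_charFun {v : NNReal} (hv : v ≠ 0) (ρ : Measure ℝ)
    [IsFiniteMeasure ρ] :
    ((∫ z, gaussianPDFReal 0 v z ∂ρ : ℝ) : ℂ) = (1 / (2 * Real.pi) : ℝ) *
      ∫ t : ℝ, charFun ρ t * Complex.exp (-(v / 2 : ℂ) * t ^ 2) := by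
  rw [← integral_complex_ofReal]
  simp_rw [gaussianPDFReal_eq_integral_exp hv]
  rw [integral_const_mul, integral_integral_swap]
  · simp_rw [integral_mul_const, charFun_apply_real]
  · have h1 : Integrable (fun q : ℝ × ℝ => (1 : ℂ) * Complex.exp (-(v / 2 : ℂ) * q.2 ^ 2))
        (ρ.prod volume) :=
      (integrable_const (1 : ℂ)).mul_prod (integrable_exp_neg_half_mul_sq hv)
    refine h1.mono (by fun_prop) (ae_of_all _ fun q => ?_)
    have : ‖Complex.exp (q.2 * q.1 * Complex.I)‖ = 1 := by
      rw [← Complex.ofReal_mul, Complex.norm_exp_ofReal_mul_I]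
    simp [Function.uncurry, this]

lemma norm_charFun_restrict_Ico_le {a x t : ℝ} (hax : a ≤ x) (ht : t ≠ 0) :
    ‖charFun (volume.restrict (Set.Ico a x)) t‖ ≤ 2 / |t| := by
  rw [charFun_apply_real, integral_Ico_eq_integral_Ioc, ← intervalIntegral.integral_of_le hax]
  have hc : (t : ℂ) * Complex.I ≠ 0 := by simpa using ht
  have e : ∀ y : ℝ, (t : ℂ) * y * Complex.I = t * Complex.I * y := fun y => by ring
  simp_rw [e]
  rw [integral_exp_mul_complex hc, norm_div]
  have n : ∀ y : ℝ, ‖Complex.exp (t * Complex.I * y)‖ = 1 := fun y => by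
    rw [← e, ← Complex.ofReal_mul, Complex.norm_exp_ofReal_mul_I]
  have : ‖(t : ℂ) * Complex.I‖ = |t| := by simp
  rw [this]
  gcongr
  exact (norm_sub_le _ _).trans (by rw [n, n]; norm_num)

lemma measureReal_conv_gaussianReal_Ioc {v : NNReal} (hv : v ≠ 0) (μ : Measure ℝ)
    [IsProbabilityMeasure μ] (a x : ℝ) :
    (μ.conv (gaussianReal 0 v)).real (Set.Ioc a x)
      = ∫ z, gaussianPDFReal 0 v z ∂(μ.conv (volume.restrict (Set.Ico (-x) (-a)))) := by
  have hS : MeasurableSet (Set.Ioc a x) := measurableSet_Ioc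
  have hb : ∀ z, gaussianPDFReal 0 v z ≤ (Real.sqrt (2 * Real.pi * v))⁻¹ := fun z => by
    rw [gaussianPDFReal]
    refine mul_le_of_le_one_right (by positivity) (Real.exp_le_one_iff.2 ?_)
    have : 0 ≤ (z - 0) ^ 2 / (2 * (v : ℝ)) := by positivity
    rw [neg_div]; linarith
  rw [← integral_indicator_one hS, integral_conv, integral_conv]
  · congr 1
    funext y
    rw [integral_gaussianReal_eq_integral_smul hv,
      ← integral_sub_left_eq_self _ volume (-y), ← integral_indicator measurableSet_Ico]
    congr 1
    funext s
    have h1 : gaussianPDFReal 0 v (-y - s) = gaussianPDFReal 0 v (y + s) := by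
      simp only [gaussianPDFReal]; congr 2; ring
    rw [h1, show y + (-y - s) = -s by ring]
    by_cases hs : s ∈ Set.Ico (-x) (-a)
    · have : -s ∈ Set.Ioc a x := ⟨by linarith [hs.2], by linarith [hs.1]⟩
      simp [Set.indicator_of_mem hs, Set.indicator_of_mem this]
    · have : -s ∉ Set.Ioc a x := fun h => hs ⟨by linarith [h.2], by linarith [h.1]⟩
      simp [Set.indicator_of_notMem hs, Set.indicator_of_notMem this]
  · refine Integrable.of_bound (measurable_gaussianPDFReal 0 v).aestronglyMeasurable
      (Real.sqrt (2 * Real.pi * v))⁻¹ (ae_of_all _ fun z => ?_)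
    rw [Real.norm_of_nonneg (gaussianPDFReal_nonneg 0 v z)]
    exact hb z
  · exact (integrable_const (1 : ℝ)).indicator hS

lemma norm_cexp_neg_half_mul_sq (v : NNReal) (t : ℝ) :
    ‖Complex.exp (-(v / 2 : ℂ) * t ^ 2)‖ = Real.exp (-(v / 2) * t ^ 2) := by
  rw [Complex.norm_exp]; congr 1
  have : (-(v / 2 : ℂ) * t ^ 2) = ((-(v / 2) * t ^ 2 : ℝ) : ℂ) := by push_cast; rfl
  rw [this, Complex.ofReal_re]

lemma integrable_abs_rpow_mul_exp {w p : ℝ} (hw : 0 < w) (hp : 0 ≤ p) :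
    Integrable (fun t : ℝ => |t| ^ p * Real.exp (-w * t ^ 2)) := by
  have h : IntegrableOn (fun t : ℝ => |t| ^ p * Real.exp (-w * t ^ 2)) (Set.Ioi 0) :=
    (integrableOn_rpow_mul_exp_neg_mul_sq hw (by linarith : (-1 : ℝ) < p)).congr_fun
      (fun t ht => by simp only [abs_of_pos (Set.mem_Ioi.1 ht)]) measurableSet_Ioi
  have h' := (Measure.measurePreserving_neg (volume : Measure ℝ)).integrableOn_comp_preimage
    (Homeomorph.neg ℝ).measurableEmbedding |>.2 h
  simp only [Function.comp_def, abs_neg, neg_sq, Set.neg_preimage, Set.neg_Ioi, neg_zero] at h'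
  rw [← integrableOn_univ, ← Set.Iic_union_Ioi (a := (0 : ℝ)), integrableOn_union,
    integrableOn_Iic_iff_integrableOn_Iio]
  exact ⟨h', h⟩

lemma abs_sub_conv_gaussianReal_Ioc_le {v : NNReal} (hv : v ≠ 0) (μ μ' : Measure ℝ)
    [IsProbabilityMeasure μ] [IsProbabilityMeasure μ'] {K p : ℝ} (hp : 0 ≤ p)
    (hK : ∀ t : ℝ, ‖charFun μ t - charFun μ' t‖ ≤ K * (|t| * |t| ^ p)) {a x : ℝ} (hax : a ≤ x) :
    |(μ.conv (gaussianReal 0 v)).real (Set.Ioc a x)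
        - (μ'.conv (gaussianReal 0 v)).real (Set.Ioc a x)|
      ≤ K / Real.pi * ∫ t : ℝ, |t| ^ p * Real.exp (-(v / 2) * t ^ 2) := by
  have hv0 : (0 : ℝ) < v := by positivity
  set lam := volume.restrict (Set.Ico (-x) (-a)) with hlam
  have hint : ∀ (m : Measure ℝ) [IsProbabilityMeasure m], Integrable (fun t : ℝ =>
      charFun (m.conv lam) t * Complex.exp (-(v / 2 : ℂ) * t ^ 2)) := fun m _ =>
    (integrable_exp_neg_half_mul_sq hv).bdd_mul
      (measurable_charFun.aestronglyMeasurable) (ae_of_all _ fun t => norm_charFun_le t)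
  rw [← Real.norm_eq_abs, ← Complex.norm_real, Complex.ofReal_sub, measureReal_conv_gaussianReal_Ioc hv,
    measureReal_conv_gaussianReal_Ioc hv, integral_gaussianPDFReal_eq_integral_charFun hv,
    integral_gaussianPDFReal_eq_integral_charFun hv, ← mul_sub, ← integral_sub (hint μ) (hint μ'),
    norm_mul, Complex.norm_real, Real.norm_of_nonneg (by positivity)]
  have key : ‖∫ t : ℝ, (charFun (μ.conv lam) t * Complex.exp (-(v / 2 : ℂ) * t ^ 2)
      - charFun (μ'.conv lam) t * Complex.exp (-(v / 2 : ℂ) * t ^ 2))‖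
      ≤ ∫ t : ℝ, 2 * K * (|t| ^ p * Real.exp (-(v / 2) * t ^ 2)) := by
    refine norm_integral_le_of_norm_le
      ((integrable_abs_rpow_mul_exp (by positivity) hp).const_mul _) ?_
    have : ∀ᵐ t : ℝ, t ≠ 0 := by simp [ae_iff]
    filter_upwards [this] with t ht
    rw [charFun_conv, charFun_conv, ← sub_mul, ← sub_mul, norm_mul, norm_mul,
      norm_cexp_neg_half_mul_sq]
    have h1 := norm_charFun_restrict_Ico_le (neg_le_neg hax) ht
    have ht' : 0 < |t| := abs_pos.2 ht
    calc ‖charFun μ t - charFun μ' t‖ * ‖charFun lam t‖ * Real.exp (-(v / 2) * t ^ 2)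
        ≤ (K * (|t| * |t| ^ p)) * (2 / |t|) * Real.exp (-(v / 2) * t ^ 2) := by
          gcongr
          · exact (norm_nonneg _).trans (hK t)
          · exact hK t
      _ = _ := by field_simp
  rw [integral_const_mul] at key
  calc _ ≤ 1 / (2 * Real.pi) * (2 * K * ∫ t : ℝ, |t| ^ p * Real.exp (-(v / 2) * t ^ 2)) := by
        gcongr
    _ = _ := by field_simp

lemma abs_sub_conv_gaussianReal_Iic_le {v : NNReal} (hv : v ≠ 0) (μ μ' : Measure ℝ)
    [IsProbabilityMeasure μ] [IsProbabilityMeasure μ'] {K p : ℝ} (hp : 0 ≤ p)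
    (hK : ∀ t : ℝ, ‖charFun μ t - charFun μ' t‖ ≤ K * (|t| * |t| ^ p)) (x : ℝ) :
    |(μ.conv (gaussianReal 0 v)).real (Set.Iic x)
        - (μ'.conv (gaussianReal 0 v)).real (Set.Iic x)|
      ≤ K / Real.pi * ∫ t : ℝ, |t| ^ p * Real.exp (-(v / 2) * t ^ 2) := by
  set S := μ.conv (gaussianReal 0 v)
  set S' := μ'.conv (gaussianReal 0 v)
  have h0 : Filter.Tendsto (fun a => |(cdf S x - cdf S a) - (cdf S' x - cdf S' a)|)
      Filter.atBot (nhds |(cdf S x - 0) - (cdf S' x - 0)|) :=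
    ((tendsto_const_nhds.sub (tendsto_cdf_atBot S)).sub
      (tendsto_const_nhds.sub (tendsto_cdf_atBot S'))).abs
  rw [← cdf_eq_real, ← cdf_eq_real, ← sub_zero (cdf S x), ← sub_zero (cdf S' x)]
  refine le_of_tendsto h0 ?_
  filter_upwards [Filter.eventually_le_atBot x] with a ha
  have e : ∀ (m : Measure ℝ) [IsProbabilityMeasure m],
      cdf m x - cdf m a = m.real (Set.Ioc a x) := fun m _ => by
    rw [cdf_eq_real, cdf_eq_real, ← Set.Iic_sdiff_Iic,
      measureReal_sdiff (Set.Iic_subset_Iic.2 ha) measurableSet_Iic]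
  rw [e, e]
  exact abs_sub_conv_gaussianReal_Ioc_le hv μ μ' hp hK ha

lemma measureReal_conv_Iic (μ γ : Measure ℝ) [IsProbabilityMeasure μ] [IsProbabilityMeasure γ]
    (x : ℝ) : (μ.conv γ).real (Set.Iic x) = ∫ z, μ.real (Set.Iic (x - z)) ∂γ := by
  rw [Measure.conv_comm, ← integral_indicator_one measurableSet_Iic, integral_conv]
  · congr 1
    funext z
    rw [← integral_indicator_one measurableSet_Iic]
    congr 1
    funext y
    simp only [Set.indicator, Set.mem_Iic, le_sub_iff_add_le']
    rfl
  · exact (integrable_const (1 : ℝ)).indicator measurableSet_Iic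

lemma le_of_abs_integral_smoothing_le {D : ℝ → ℝ} (hD : Measurable D) {γ : Measure ℝ}
    [IsProbabilityMeasure γ] {H η A r : ℝ} (hH : 0 ≤ H) (hη : ∀ x, |D x| ≤ η)
    (hlip : ∀ x y, x ≤ y → D x - H * (y - x) ≤ D y)
    (hA : ∀ x, |∫ z, D (x - z) ∂γ| ≤ A) (hγ : γ.real {z | r < |z|} ≤ 1 / 4) (x : ℝ) :
    D x ≤ 4 / 3 * A + η / 3 + 2 * r * H := by
  have hη0 : 0 ≤ η := (abs_nonneg _).trans (hη 0)
  have hA0 : 0 ≤ A := (abs_nonneg _).trans (hA 0)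
  have hs : MeasurableSet {z : ℝ | r < |z|} := measurableSet_lt measurable_const (by fun_prop)
  set L := D x - 2 * r * H with hL
  have hpt : ∀ z, L - (L + η) * {z : ℝ | r < |z|}.indicator 1 z ≤ D (x + r - z) := fun z => by
    by_cases hz : r < |z|
    · have : z ∈ {z : ℝ | r < |z|} := hz
      rw [Set.indicator_of_mem this]
      have := neg_abs_le (D (x + r - z))
      have := hη (x + r - z)
      simp only [Pi.one_apply]; linarith
    · have : z ∉ {z : ℝ | r < |z|} := hz
      rw [Set.indicator_of_notMem this]
      have hz' := abs_le.1 (not_lt.1 hz)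
      have := hlip x (x + r - z) (by linarith [hz'.2])
      nlinarith [hz'.1]
  have hint : Integrable (fun z => D (x + r - z)) γ :=
    Integrable.of_bound (hD.comp (by fun_prop)).aestronglyMeasurable η
      (ae_of_all _ fun z => hη _)
  have hint2 : Integrable (fun z => (L + η) * {z : ℝ | r < |z|}.indicator (1 : ℝ → ℝ) z) γ :=
    ((integrable_const (1 : ℝ)).indicator hs).const_mul _
  have h1 := integral_mono ((integrable_const L).sub hint2) hint hpt
  simp only [Pi.sub_apply] at h1
  rw [integral_sub (integrable_const L) hint2, integral_const_mul, integral_indicator_one hs] at h1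
  simp only [integral_const, probReal_univ, smul_eq_mul, one_mul] at h1
  have h2 := (le_abs_self _).trans (hA (x + r))
  have h0 : 0 ≤ γ.real {z : ℝ | r < |z|} := measureReal_nonneg
  rcases le_or_gt 0 (L + η) with h | h
  · nlinarith
  · have : D x ≤ 2 * r * H - η := by linarith
    linarith

lemma gaussianReal_abs_gt_le {s : NNReal} (hs : s ≠ 0) :
    (gaussianReal 0 (s ^ 2)).real {z | 2 * (s : ℝ) < |z|} ≤ 1 / 4 := by
  have hs0 : (0 : ℝ) < s := by positivity
  have h := meas_ge_le_variance_div_sq (memLp_id_gaussianReal' (μ := 0) (v := s ^ 2) 2 (by simp))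
    (c := 2 * (s : ℝ)) (by positivity)
  rw [variance_id_gaussianReal] at h
  simp only [id_eq, integral_id_gaussianReal, sub_zero] at h
  have h2 : (gaussianReal 0 (s ^ 2)).real {z | 2 * (s : ℝ) ≤ |z|} ≤ 1 / 4 := by
    refine ENNReal.toReal_le_of_le_ofReal (by norm_num) (h.trans (le_of_eq ?_))
    congr 1
    push_cast
    field_simp
    norm_num
  refine (measureReal_mono fun z hz => ?_).trans h2
  exact le_of_lt (Set.mem_ofPred_eq ▸ hz)

/-- A Gaussian-kernel version of Esseen's smoothing inequality. -/
theorem kolmogorovDist_le_of_norm_charFun_sub_le (μ μ' : Measure ℝ)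
    [IsProbabilityMeasure μ] [IsProbabilityMeasure μ'] {K p H : ℝ} (hp : 0 ≤ p) (hH : 0 ≤ H)
    (hK : ∀ t : ℝ, ‖charFun μ t - charFun μ' t‖ ≤ K * (|t| * |t| ^ p))
    (hdens : ∀ x y, x ≤ y → μ'.real (Set.Ioc x y) ≤ H * (y - x)) {σ : ℝ} (hσ : 0 < σ) :
    kolmogorovDist μ μ' ≤ 2 * (K / Real.pi * (σ ^ (-(p + 1)) *
      ∫ t : ℝ, |t| ^ p * Real.exp (-(1 / 2) * t ^ 2))) + 6 * H * σ := by
  lift σ to NNReal using hσ.le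
  have hs : σ ≠ 0 := by rintro rfl; simp at hσ
  set D : ℝ → ℝ := fun x => μ.real (Set.Iic x) - μ'.real (Set.Iic x) with hD
  have hmon : ∀ (m : Measure ℝ) [IsProbabilityMeasure m],
      Monotone (fun x => m.real (Set.Iic x)) := fun m _ x y hxy =>
    measureReal_mono (Set.Iic_subset_Iic.2 hxy)
  have hDm : Measurable D := (hmon μ).measurable.sub (hmon μ').measurable
  have hD1 : ∀ x, |D x| ≤ 1 := fun x => by
    have h1 : μ.real (Set.Iic x) ≤ 1 := measureReal_le_one
    have h2 : μ'.real (Set.Iic x) ≤ 1 := measureReal_le_one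
    have h3 : 0 ≤ μ.real (Set.Iic x) := measureReal_nonneg
    have h4 : 0 ≤ μ'.real (Set.Iic x) := measureReal_nonneg
    exact abs_le.2 ⟨by simp only [hD]; linarith, by simp only [hD]; linarith⟩
  have hη : ∀ x, |D x| ≤ kolmogorovDist μ μ' :=
    fun x => le_ciSup (f := fun x => |D x|) ⟨1, by rintro _ ⟨y, rfl⟩; exact hD1 y⟩ x
  have hlip : ∀ x y, x ≤ y → D x - H * (y - x) ≤ D y := fun x y hxy => by
    have h1 := hmon μ hxy
    have h2 := hdens x y hxy
    rw [← Set.Iic_sdiff_Iic, measureReal_sdiff (Set.Iic_subset_Iic.2 hxy) measurableSet_Iic] at h2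
    simp only [hD] at *
    linarith
  set γ := gaussianReal 0 (σ ^ 2) with hγ
  set A := K / Real.pi * ((σ : ℝ) ^ (-(p + 1)) *
      ∫ t : ℝ, |t| ^ p * Real.exp (-(1 / 2) * t ^ 2)) with hAdef
  have hscale : ∫ t : ℝ, |t| ^ p * Real.exp (-(((σ ^ 2 : NNReal) : ℝ) / 2) * t ^ 2)
      = (σ : ℝ) ^ (-(p + 1)) * ∫ t : ℝ, |t| ^ p * Real.exp (-(1 / 2) * t ^ 2) := by
    have h := Measure.integral_comp_mul_left
      (fun t : ℝ => |t| ^ p * Real.exp (-(1 / 2) * t ^ 2)) (σ : ℝ)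
    have e : (fun t : ℝ => |(σ : ℝ) * t| ^ p * Real.exp (-(1 / 2) * ((σ : ℝ) * t) ^ 2))
        = fun t : ℝ => (σ : ℝ) ^ p *
          (|t| ^ p * Real.exp (-(((σ ^ 2 : NNReal) : ℝ) / 2) * t ^ 2)) := by
      funext t
      rw [abs_mul, abs_of_pos hσ, Real.mul_rpow hσ.le (abs_nonneg t), mul_assoc]
      push_cast
      congr 3
      ring
    rw [e, integral_const_mul, abs_of_pos (inv_pos.2 hσ), smul_eq_mul] at h
    rw [neg_add, Real.rpow_add hσ, Real.rpow_neg hσ.le, Real.rpow_neg_one, mul_assoc, ← h,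
      inv_mul_cancel_left₀ (by positivity)]
  have hA : ∀ x, |∫ z, D (x - z) ∂γ| ≤ A := fun x => by
    have hi : ∀ (m : Measure ℝ) [IsProbabilityMeasure m],
        Integrable (fun z => m.real (Set.Iic (x - z))) γ := fun m _ =>
      Integrable.of_bound ((hmon m).measurable.comp (by fun_prop)).aestronglyMeasurable 1
        (ae_of_all _ fun z => by
          rw [Real.norm_of_nonneg measureReal_nonneg]; exact measureReal_le_one)
    simp only [hD]
    rw [integral_sub (hi μ) (hi μ'), ← measureReal_conv_Iic, ← measureReal_conv_Iic, hAdef,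
      ← hscale]
    exact abs_sub_conv_gaussianReal_Iic_le (pow_ne_zero 2 hs) μ μ' hp hK x
  have htail := gaussianReal_abs_gt_le hs
  have hup := le_of_abs_integral_smoothing_le hDm hH hη hlip hA htail
  have hlow := le_of_abs_integral_smoothing_le (D := fun x => -D (-x)) (hDm.comp measurable_neg).neg
    hH (fun x => by rw [abs_neg]; exact hη (-x))
    (fun x y hxy => by have := hlip (-y) (-x) (neg_le_neg hxy); linarith)
    (fun x => by
      have hinv : γ.map (fun z => -z) = γ := by rw [hγ, gaussianReal_map_neg, neg_zero]
      have h := hA (-x)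
      have hm : Measurable fun z => D (-x - z) := hDm.comp (by fun_prop)
      rw [← hinv, integral_map (by fun_prop) hm.aestronglyMeasurable] at h
      rw [integral_neg, abs_neg]
      convert h using 5
      ring) htail
  have hfin : kolmogorovDist μ μ' ≤ 4 / 3 * A + kolmogorovDist μ μ' / 3 + 2 * (2 * σ) * H := by
    refine ciSup_le fun x => abs_le.2 ⟨?_, hup x⟩
    have := hlow (-x)
    rw [neg_neg] at this
    change _ ≤ D x
    linarith
  linarith

lemma one_sub_cos_le_mul_inv (y : ℝ) : 1 - Real.cos y ≤ 4 * y ^ 2 * (1 + y ^ 2)⁻¹ := by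
  rw [← div_eq_mul_inv, le_div_iff₀ (by positivity)]
  nlinarith [Real.one_sub_sq_div_two_le_cos (x := y), Real.neg_one_le_cos y, sq_nonneg y]

lemma lintegral_one_sub_cos_div_sq_le (s : Set ℝ) (x : ℝ) :
    ∫⁻ t in s, ENNReal.ofReal ((1 - Real.cos (t * x)) / t ^ 2)
      ≤ ENNReal.ofReal (4 * Real.pi * |x|) := by
  rcases eq_or_ne x 0 with rfl | hx
  · simp
  have hpt : ∀ t : ℝ, (1 - Real.cos (t * x)) / t ^ 2 ≤ 4 * x ^ 2 * (1 + (x * t) ^ 2)⁻¹ := fun t => by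
    rcases eq_or_ne t 0 with rfl | ht
    · simp; positivity
    rw [div_le_iff₀ (by positivity)]
    refine (one_sub_cos_le_mul_inv (t * x)).trans (le_of_eq ?_)
    rw [mul_comm x t]; ring
  have hint : Integrable (fun t : ℝ => 4 * x ^ 2 * (1 + (x * t) ^ 2)⁻¹) :=
    (integrable_inv_one_add_sq.comp_mul_left' hx).const_mul _
  calc _ ≤ ∫⁻ t, ENNReal.ofReal ((1 - Real.cos (t * x)) / t ^ 2) := setLIntegral_le_lintegral _ _
    _ ≤ ∫⁻ t, ENNReal.ofReal (4 * x ^ 2 * (1 + (x * t) ^ 2)⁻¹) :=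
        lintegral_mono fun t => ENNReal.ofReal_le_ofReal (hpt t)
    _ = ENNReal.ofReal (4 * Real.pi * |x|) := by
        rw [← ofReal_integral_eq_lintegral_ofReal hint (ae_of_all _ fun t => by positivity),
          integral_const_mul, Measure.integral_comp_mul_left (fun t : ℝ => (1 + t ^ 2)⁻¹),
          integral_univ_inv_one_add_sq, smul_eq_mul, abs_inv, ← sq_abs x]
        congr 1
        have : |x| ≠ 0 := by simpa using hx
        field_simp

lemma le_lintegral_one_sub_cos_div_sq {δ u : ℝ} (hδ : 0 < δ) (hδ1 : δ ≤ 1) (hu : 1 ≤ |u|) :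
    ENNReal.ofReal (2 / Real.pi ^ 2 * δ * |u|)
      ≤ ∫⁻ t in Set.Ioc 0 δ, ENNReal.ofReal ((1 - Real.cos (t * u)) / t ^ 2) := by
  have hu0 : 0 < |u| := by linarith
  calc ENNReal.ofReal (2 / Real.pi ^ 2 * δ * |u|)
      = ∫⁻ t in Set.Ioc 0 (δ / |u|), ENNReal.ofReal (2 / Real.pi ^ 2 * u ^ 2) := by
        rw [setLIntegral_const, Real.volume_Ioc, sub_zero, ← ENNReal.ofReal_mul (by positivity),
          ← sq_abs u]
        congr 1
        field_simp
    _ ≤ ∫⁻ t in Set.Ioc 0 (δ / |u|), ENNReal.ofReal ((1 - Real.cos (t * u)) / t ^ 2) := by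
        refine setLIntegral_mono' measurableSet_Ioc fun t ht => ENNReal.ofReal_le_ofReal ?_
        have ht0 : 0 < t := ht.1
        have h1 : |t * u| ≤ Real.pi := by
          rw [abs_mul, abs_of_pos ht0]
          have := (le_div_iff₀ hu0).1 ht.2
          linarith [Real.pi_gt_three]
        rw [le_div_iff₀ (by positivity)]
        have := Real.cos_le_one_sub_mul_cos_sq h1
        rw [mul_pow] at this
        linarith
    _ ≤ _ := lintegral_mono_set (Set.Ioc_subset_Ioc_right (div_le_self hδ.le hu))

section

variable {μ : Measure ℝ} {b : ℝ} {ν : Measure ℝ}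

lemma IsLevyMeasure.measure_compl_Icc_lt_top (hν : IsLevyMeasure ν) :
    ν (Set.Icc (-1 : ℝ) 1)ᶜ < ⊤ := by
  refine lt_of_le_of_lt ?_ hν.lintegral_lt_top
  calc ν (Set.Icc (-1 : ℝ) 1)ᶜ = ∫⁻ u in (Set.Icc (-1 : ℝ) 1)ᶜ, 1 ∂ν := by simp
    _ ≤ ∫⁻ u in (Set.Icc (-1 : ℝ) 1)ᶜ, ENNReal.ofReal (min 1 (u ^ 2)) ∂ν := by
        refine setLIntegral_mono' measurableSet_Icc.compl fun u hu => ?_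
        have h1 : 1 ≤ u ^ 2 := by
          rw [Set.mem_compl_iff, Set.mem_Icc, ← abs_le, not_le] at hu
          exact (one_lt_sq_iff_one_lt_abs u).2 hu |>.le
        rw [min_eq_left h1, ENNReal.ofReal_one]
    _ ≤ _ := setLIntegral_le_lintegral _ _

lemma norm_exp_I_mul_mul_sub_one_le (t u : ℝ) :
    ‖Complex.exp (Complex.I * t * u) - 1‖ ≤ |t| * |u| := by
  have := Real.norm_exp_I_mul_ofReal_sub_one_le (x := t * u)
  rwa [Real.norm_eq_abs, abs_mul, Complex.ofReal_mul, ← mul_assoc] at this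

lemma norm_exp_I_mul_mul (t u : ℝ) : ‖Complex.exp (Complex.I * t * u)‖ = 1 := by
  rw [mul_assoc, ← Complex.ofReal_mul, Complex.norm_exp_I_mul_ofReal]

lemma IsLevyMeasure.integrable_exp_sub_one (hν : IsLevyMeasure ν)
    (h1 : IntegrableOn (fun u : ℝ => |u|) (Set.Icc (-1) 1) ν) (t : ℝ) :
    Integrable (fun u : ℝ => Complex.exp (Complex.I * t * u) - 1) ν := by
  rw [← integrableOn_univ, ← Set.union_compl_self (Set.Icc (-1 : ℝ) 1), integrableOn_union]
  constructor
  · refine (h1.const_mul |t|).mono (by fun_prop) (ae_of_all _ fun u => ?_)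
    rw [norm_mul, Real.norm_eq_abs, Real.norm_eq_abs, abs_abs, abs_abs]
    exact norm_exp_I_mul_mul_sub_one_le t u
  · refine Measure.integrableOn_of_bounded (M := 2) hν.measure_compl_Icc_lt_top.ne (by fun_prop)
      (ae_of_all _ fun u => ?_)
    refine (norm_sub_le _ _).trans ?_
    rw [norm_exp_I_mul_mul, norm_one]; norm_num

lemma levyKhintchineExponent_eq_drift (hν : IsLevyMeasure ν)
    (h1 : IntegrableOn (fun u : ℝ => |u|) (Set.Icc (-1) 1) ν) (b t : ℝ) :
    levyKhintchineExponent b 0 ν t = Complex.I * t * levyDrift b ν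
      + ∫ u : ℝ, (Complex.exp (Complex.I * t * u) - 1) ∂ν := by
  have h1' : IntegrableOn (fun u : ℝ => u) (Set.Icc (-1) 1) ν :=
    Integrable.mono h1 (by fun_prop) (ae_of_all _ fun u => by simp)
  have h2 : Integrable ((Set.Icc (-1 : ℝ) 1).indicator
      (fun w : ℝ => Complex.I * (t : ℂ) * (w : ℂ))) ν :=
    (integrable_indicator_iff measurableSet_Icc).2 (h1'.ofReal.const_mul _)
  rw [levyKhintchineExponent, integral_sub (hν.integrable_exp_sub_one h1 t) h2,
    integral_indicator measurableSet_Icc, integral_const_mul, levyDrift, Complex.ofReal_sub,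
    integral_complex_ofReal]
  push_cast
  ring

lemma IsLevyMeasure.integrable_one_sub_cos (hν : IsLevyMeasure ν)
    (h1 : IntegrableOn (fun u : ℝ => |u|) (Set.Icc (-1) 1) ν) (t : ℝ) :
    Integrable (fun u : ℝ => 1 - Real.cos (t * u)) ν := by
  have := (hν.integrable_exp_sub_one h1 t).re.neg
  refine this.congr (ae_of_all _ fun u => ?_)
  have : Complex.I * t * u = ((t * u : ℝ) : ℂ) * Complex.I := by push_cast; ring
  simp [this, Complex.exp_ofReal_mul_I_re, -Complex.ofReal_mul]

lemma IsIDLaw.norm_charFun_eq (h : IsIDLaw μ b 0 ν)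
    (h1 : IntegrableOn (fun u : ℝ => |u|) (Set.Icc (-1) 1) ν) (t : ℝ) :
    ‖charFun μ t‖ = Real.exp (-∫ u, (1 - Real.cos (t * u)) ∂ν) := by
  rw [h.charFun_eq, Complex.norm_exp, levyKhintchineExponent_eq_drift h.isLevyMeasure h1]
  congr 1
  have hre := integral_re (𝕜 := ℂ) (h.isLevyMeasure.integrable_exp_sub_one h1 t)
  simp only [RCLike.re_eq_complex_re] at hre
  rw [Complex.add_re, ← hre, ← integral_neg]
  have h0 : (Complex.I * t * (levyDrift b ν : ℂ)).re = 0 := by simp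
  rw [h0, zero_add]
  congr 1
  funext u
  have : Complex.I * t * u = ((t * u : ℝ) : ℂ) * Complex.I := by push_cast; ring
  simp [this, Complex.exp_ofReal_mul_I_re, -Complex.ofReal_mul]

lemma integrable_one_sub_cos_mul [IsFiniteMeasure μ] (t : ℝ) :
    Integrable (fun x : ℝ => 1 - Real.cos (t * x)) μ := by
  refine Integrable.of_bound (by fun_prop) 2 (ae_of_all _ fun x => ?_)
  rw [Real.norm_eq_abs, abs_le]
  constructor <;> linarith [Real.cos_le_one (t * x), Real.neg_one_le_cos (t * x)]

lemma one_sub_norm_charFun_le [IsProbabilityMeasure μ] (t : ℝ) :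
    1 - ‖charFun μ t‖ ≤ ∫ x, (1 - Real.cos (t * x)) ∂μ := by
  have h := Complex.re_le_norm (charFun μ t)
  have hint : Integrable (fun x : ℝ => Complex.exp (t * x * Complex.I)) μ :=
    Integrable.of_bound (by fun_prop) 1 (ae_of_all _ fun x => by
      rw [← Complex.ofReal_mul, Complex.norm_exp_ofReal_mul_I])
  have hre := integral_re (𝕜 := ℂ) hint
  simp only [RCLike.re_eq_complex_re, ← Complex.ofReal_mul, Complex.exp_ofReal_mul_I_re] at hre
  have hc : Integrable (fun x : ℝ => Real.cos (t * x)) μ :=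
    ((integrable_const (1 : ℝ)).sub (integrable_one_sub_cos_mul (μ := μ) t)).congr
      (ae_of_all _ fun x => by simp)
  rw [charFun_apply_real] at h
  simp only [← Complex.ofReal_mul] at h
  rw [integral_sub (integrable_const 1) hc, hre]
  simp only [integral_const, probReal_univ, smul_eq_mul, mul_one]
  rw [charFun_apply_real]
  simp only [← Complex.ofReal_mul]
  linarith

/-- If an infinitely divisible law has a first moment, so does its Lévy measure at infinity. -/
theorem IsIDLaw.integrable_abs_levyMeasure (h : IsIDLaw μ b 0 ν)
    (h1 : IntegrableOn (fun u : ℝ => |u|) (Set.Icc (-1) 1) ν)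
    (hμ : Integrable (fun x : ℝ => x) μ) : Integrable (fun u : ℝ => |u|) ν := by
  have := h.isProbabilityMeasure
  have hν := h.isLevyMeasure
  rw [← integrableOn_univ, ← Set.union_compl_self (Set.Icc (-1 : ℝ) 1), integrableOn_union]
  refine ⟨h1, ?_⟩
  set ν₁ := ν.restrict (Set.Icc (-1 : ℝ) 1)ᶜ with hν₁
  have : IsFiniteMeasure ν₁ := ⟨by simpa [hν₁] using hν.measure_compl_Icc_lt_top⟩
  obtain ⟨δ, hδ, hδ1, hk⟩ : ∃ δ : ℝ, 0 < δ ∧ δ ≤ 1 ∧ ∀ t ∈ Set.Ioc 0 δ,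
      1 / 2 < ‖charFun μ t‖ := by
    have hc : Filter.Tendsto (fun t => ‖charFun μ t‖) (nhds (0 : ℝ)) (nhds ‖charFun μ 0‖) :=
      (continuous_charFun (μ := μ)).norm.tendsto 0
    have h0 : (1 / 2 : ℝ) < ‖charFun μ (0 : ℝ)‖ := by simp [charFun_zero]; norm_num
    obtain ⟨ε, hε, hb⟩ := Metric.eventually_nhds_iff.1 (hc.eventually_const_lt h0)
    refine ⟨min (ε / 2) 1, by positivity, min_le_right _ _, fun t ht => hb ?_⟩
    rw [Real.dist_eq, sub_zero, abs_of_pos ht.1]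
    linarith [ht.2.trans (min_le_left _ _)]
  have hcos : ∀ y : ℝ, 0 ≤ 1 - Real.cos y := fun y => by linarith [Real.cos_le_one y]
  have hkey : ∀ t ∈ Set.Ioc 0 δ,
      ∫ u, (1 - Real.cos (t * u)) ∂ν₁ ≤ 2 * ∫ x, (1 - Real.cos (t * x)) ∂μ := fun t ht => by
    have hle : ∫ u, (1 - Real.cos (t * u)) ∂ν₁ ≤ ∫ u, (1 - Real.cos (t * u)) ∂ν :=
      setIntegral_le_integral (hν.integrable_one_sub_cos h1 t) (ae_of_all _ fun u => hcos _)
    have hk0 : 0 ≤ ∫ u, (1 - Real.cos (t * u)) ∂ν := integral_nonneg fun u => hcos _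
    have h2 := one_sub_norm_charFun_le (μ := μ) t
    have h3 := hk t ht
    rw [h.norm_charFun_eq h1 t] at h2 h3
    set k := ∫ u, (1 - Real.cos (t * u)) ∂ν
    have h4 := Real.add_one_le_exp k
    have h5 : Real.exp (-k) * Real.exp k = 1 := by rw [← Real.exp_add]; simp
    have h6 : k ≤ 1 := by nlinarith [Real.exp_pos (-k)]
    have h7 : Real.exp (-k) ≤ 1 - k / 2 := by nlinarith [Real.exp_pos (-k)]
    linarith
  have hmeas : Measurable (fun q : ℝ × ℝ => ENNReal.ofReal ((1 - Real.cos (q.2 * q.1)) / q.2 ^ 2)) :=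
    by fun_prop
  have hswap : ∀ (m : Measure ℝ) [IsFiniteMeasure m],
      ∫⁻ u, (∫⁻ t in Set.Ioc 0 δ, ENNReal.ofReal ((1 - Real.cos (t * u)) / t ^ 2)) ∂m
        = ∫⁻ t in Set.Ioc 0 δ,
            ENNReal.ofReal ((∫ u, (1 - Real.cos (t * u)) ∂m) / t ^ 2) := fun m _ => by
    rw [lintegral_lintegral_swap hmeas.aemeasurable]
    congr 1
    funext t
    rw [← integral_div, ofReal_integral_eq_lintegral_ofReal
      ((integrable_one_sub_cos_mul t).div_const _)
      (ae_of_all _ fun u => div_nonneg (hcos _) (sq_nonneg _))]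
  have hfin : ∫⁻ u, ENNReal.ofReal (2 / Real.pi ^ 2 * δ * |u|) ∂ν₁ < ⊤ := by
    calc _ ≤ ∫⁻ u, (∫⁻ t in Set.Ioc 0 δ, ENNReal.ofReal ((1 - Real.cos (t * u)) / t ^ 2)) ∂ν₁ := by
          refine setLIntegral_mono' measurableSet_Icc.compl fun u hu => ?_
          rw [Set.mem_compl_iff, Set.mem_Icc, ← abs_le, not_le] at hu
          exact le_lintegral_one_sub_cos_div_sq hδ hδ1 hu.le
      _ = ∫⁻ t in Set.Ioc 0 δ, ENNReal.ofReal ((∫ u, (1 - Real.cos (t * u)) ∂ν₁) / t ^ 2) :=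
          hswap ν₁
      _ ≤ ∫⁻ t in Set.Ioc 0 δ,
            2 * ENNReal.ofReal ((∫ x, (1 - Real.cos (t * x)) ∂μ) / t ^ 2) := by
          refine setLIntegral_mono' measurableSet_Ioc fun t ht => ?_
          rw [← ENNReal.ofReal_ofNat, ← ENNReal.ofReal_mul (by norm_num), ← mul_div_assoc]
          refine ENNReal.ofReal_le_ofReal ?_
          gcongr
          exact hkey t ht
      _ = 2 * ∫⁻ x, (∫⁻ t in Set.Ioc 0 δ, ENNReal.ofReal ((1 - Real.cos (t * x)) / t ^ 2)) ∂μ := by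
          rw [lintegral_const_mul' _ _ (by simp), hswap μ]
      _ ≤ 2 * ∫⁻ x, ENNReal.ofReal (4 * Real.pi * |x|) ∂μ := by
          gcongr with x
          exact lintegral_one_sub_cos_div_sq_le _ x
      _ < ⊤ := by
          refine ENNReal.mul_lt_top (by simp) ?_
          have := (hμ.abs.const_mul (4 * Real.pi)).lintegral_lt_top
          simpa using this
  have hpos : 0 < 2 / Real.pi ^ 2 * δ := by positivity
  have hI : Integrable (fun u : ℝ => 2 / Real.pi ^ 2 * δ * |u|) ν₁ :=
    (lintegral_ofReal_ne_top_iff_integrable (by fun_prop)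
      (ae_of_all _ fun u => by positivity)).1 hfin.ne
  exact (integrable_const_mul_iff hpos.ne'.isUnit _).1 hI

end

section

variable {μ : Measure ℝ} {b : ℝ} {ν : Measure ℝ}

/-- `M = |b₀| + ∫ |u| ν(du)`, which bounds the derivative of the exponent. -/
noncomputable def levyFirstMoment (b : ℝ) (ν : Measure ℝ) : ℝ :=
  |levyDrift b ν| + ∫ u, |u| ∂ν

lemma levyFirstMoment_nonneg (b : ℝ) (ν : Measure ℝ) : 0 ≤ levyFirstMoment b ν :=
  add_nonneg (abs_nonneg _) (integral_nonneg fun _ => abs_nonneg _)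

lemma exists_hasDerivAt_levyKhintchineExponent (hν : IsLevyMeasure ν)
    (h1 : Integrable (fun u : ℝ => |u|) ν) (b t : ℝ) :
    ∃ d : ℂ, HasDerivAt (levyKhintchineExponent b 0 ν) d t ∧ ‖d‖ ≤ levyFirstMoment b ν := by
  have h1' := h1.integrableOn (s := Set.Icc (-1 : ℝ) 1)
  have he : levyKhintchineExponent b 0 ν = fun t : ℝ => Complex.I * t * levyDrift b ν
      + ∫ u : ℝ, (Complex.exp (Complex.I * t * u) - 1) ∂ν :=
    funext fun t => levyKhintchineExponent_eq_drift hν h1' b t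
  have hb : ∀ s u : ℝ, ‖Complex.exp (Complex.I * s * u) * (Complex.I * u)‖ ≤ |u| := fun s u => by
    rw [norm_mul, norm_exp_I_mul_mul]; simp
  have hd : ∀ s u : ℝ, HasDerivAt (fun s : ℝ => Complex.exp (Complex.I * s * u) - 1)
      (Complex.exp (Complex.I * s * u) * (Complex.I * u)) s := fun s u => by
    have := ((((hasDerivAt_id s).ofReal_comp.const_mul Complex.I).mul_const (u : ℂ)).cexp).sub_const 1
    simpa using this
  have hI := (hasDerivAt_integral_of_dominated_loc_of_deriv_le (μ := ν) (x₀ := t)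
    (F := fun s u : ℝ => Complex.exp (Complex.I * s * u) - 1)
    (F' := fun s u : ℝ => Complex.exp (Complex.I * s * u) * (Complex.I * u))
    (bound := fun u => |u|) Filter.univ_mem
    (Filter.Eventually.of_forall fun s => by fun_prop) (hν.integrable_exp_sub_one h1' t)
    (by fun_prop) (ae_of_all _ fun u s _ => hb s u) h1 (ae_of_all _ fun u s _ => hd s u)).2
  have h0 : HasDerivAt (fun t : ℝ => Complex.I * t * (levyDrift b ν : ℂ))
      (Complex.I * levyDrift b ν) t := by
    simpa using ((hasDerivAt_id t).ofReal_comp.const_mul Complex.I).mul_const (levyDrift b ν : ℂ)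
  rw [he]
  refine ⟨_, h0.add hI, (norm_add_le _ _).trans (add_le_add ?_ ?_)⟩
  · simp
  · exact norm_integral_le_of_norm_le h1 (ae_of_all _ fun u => hb t u)

lemma levyKhintchineExponent_zero (b : ℝ) (ν : Measure ℝ) :
    levyKhintchineExponent b 0 ν 0 = 0 := by
  simp [levyKhintchineExponent]

lemma continuous_levyKhintchineExponent (hν : IsLevyMeasure ν)
    (h1 : Integrable (fun u : ℝ => |u|) ν) (b : ℝ) :
    Continuous (levyKhintchineExponent b 0 ν) :=
  continuous_iff_continuousAt.2 fun t =>
    (exists_hasDerivAt_levyKhintchineExponent hν h1 b t).choose_spec.1.continuousAt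

lemma norm_levyKhintchineExponent_le (hν : IsLevyMeasure ν)
    (h1 : Integrable (fun u : ℝ => |u|) ν) (b t : ℝ) :
    ‖levyKhintchineExponent b 0 ν t‖ ≤ levyFirstMoment b ν * |t| := by
  rw [levyKhintchineExponent_eq_drift hν h1.integrableOn, levyFirstMoment, add_mul]
  refine (norm_add_le _ _).trans (add_le_add ?_ ?_)
  · simp [mul_comm]
  · rw [← integral_mul_const]
    refine norm_integral_le_of_norm_le (h1.mul_const _) (ae_of_all _ fun u => ?_)
    exact (norm_exp_I_mul_mul_sub_one_le t u).trans_eq (mul_comm _ _)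

lemma IsDistinguishedRoot.eq_exp_div {ψ g : ℝ → ℂ} (hψ : Continuous ψ) (hψ0 : ψ 0 = 0) {n : ℕ}
    (hn : n ≠ 0) (hg : IsDistinguishedRoot (fun t => Complex.exp (ψ t)) n g) (t : ℝ) :
    g t = Complex.exp (ψ t / n) := by
  set f : ℝ → ℂ := fun t => g t * Complex.exp (-(ψ t / n)) with hf
  have hfc : Continuous f := hg.continuous.mul (by fun_prop)
  have hpow : ∀ t, f t ^ n = 1 := fun t => by
    have : (n : ℂ) ≠ 0 := by exact_mod_cast hn
    rw [hf, mul_pow, hg.pow_eq, ← Complex.exp_nat_mul, ← Complex.exp_add, mul_neg,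
      mul_div_cancel₀ _ this, add_neg_cancel, Complex.exp_zero]
  have hfin : {z : ℂ | z ^ n = 1}.Finite := by
    refine (Polynomial.nthRootsFinset n (1 : ℂ)).finite_toSet.subset fun z hz => ?_
    exact (Polynomial.mem_nthRootsFinset (Nat.pos_of_ne_zero hn) _).2 hz
  have h := isPreconnected_univ.constant_of_mapsTo hfin.isDiscrete hfc.continuousOn
    (fun s _ => hpow s) (Set.mem_univ t) (Set.mem_univ 0)
  have h0 : f 0 = 1 := by simp [hf, hg.map_zero, hψ0]
  rw [h0] at h
  simp only [hf, Complex.exp_neg] at h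
  exact eq_of_mul_inv_eq_one h

lemma norm_exp_sub_one_le_of_re_nonpos {z : ℂ} (hz : z.re ≤ 0) : ‖Complex.exp z - 1‖ ≤ ‖z‖ := by
  have h := (convex_halfSpace_re_le 0).norm_image_sub_le_of_norm_hasDerivWithin_le (C := 1)
    (f := Complex.exp) (f' := Complex.exp) (x := 0) (y := z)
    (fun w _ => (Complex.hasDerivAt_exp w).hasDerivWithinAt)
    (fun w hw => by rw [Complex.norm_exp]; exact Real.exp_le_one_iff.2 hw) (by simp) hz
  simpa using h

/-- Comparison of `exp ψ` with its compound Poisson approximation `exp (n (exp (ψ / n) - 1))`. -/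
lemma norm_compoundPoisson_sub_le {ψ : ℝ → ℂ} {M : ℝ} (hM : 0 ≤ M)
    (hd : ∀ t, ∃ d : ℂ, HasDerivAt ψ d t ∧ ‖d‖ ≤ M) (hψ : ∀ t, ‖ψ t‖ ≤ M * |t|)
    (hre : ∀ t, (ψ t).re ≤ 0) {n : ℕ} (hn : n ≠ 0) {T : ℝ} (hT : 0 ≤ T) :
    ‖Complex.exp (n * (Complex.exp (ψ T / n) - 1)) - Complex.exp (ψ T)‖
      ≤ M ^ 2 * T / n * (‖Complex.exp (ψ T)‖ * ∫ s in (0 : ℝ)..T, 1 / ‖Complex.exp (ψ s)‖) := by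
  have hn0 : (0 : ℝ) < n := by exact_mod_cast Nat.pos_of_ne_zero hn
  have hnC : (n : ℂ) ≠ 0 := by exact_mod_cast hn
  have hψ0 : ψ 0 = 0 := by simpa using hψ 0
  have hc : Continuous ψ := continuous_iff_continuousAt.2 fun t =>
    (hd t).choose_spec.1.continuousAt
  choose d hd hdM using hd
  set F : ℝ → ℂ := fun t => Complex.exp (n * (Complex.exp (ψ t / n) - 1) - ψ t) with hF
  have hFd : ∀ t, HasDerivAt (fun t => F t - 1)
      (F t * (d t * (Complex.exp (ψ t / n) - 1))) t := fun t => by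
    have h := ((((((hd t).div_const (n : ℂ)).cexp.sub_const 1).const_mul (n : ℂ)).sub
      (hd t)).cexp).sub_const 1
    have e : n * (Complex.exp (ψ t / n) * (d t / n)) - d t
        = d t * (Complex.exp (ψ t / n) - 1) := by field_simp
    rw [e] at h
    exact h
  have hpos : ∀ t, 0 < ‖Complex.exp (ψ t)‖ := fun t => norm_pos_iff.2 (Complex.exp_ne_zero _)
  have hre' : ∀ t, (ψ t / n).re ≤ 0 := fun t => by
    rw [Complex.div_natCast_re]; exact div_nonpos_of_nonpos_of_nonneg (hre t) hn0.le
  have hcp : ∀ t, ‖Complex.exp (n * (Complex.exp (ψ t / n) - 1))‖ ≤ 1 := fun t => by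
    rw [Complex.norm_exp, Real.exp_le_one_iff]
    have h1 : (Complex.exp (ψ t / n)).re ≤ 1 := by
      refine (Complex.re_le_norm _).trans ?_
      rw [Complex.norm_exp]; exact Real.exp_le_one_iff.2 (hre' t)
    have h2 : ((n : ℂ) * (Complex.exp (ψ t / n) - 1)).re
        = n * ((Complex.exp (ψ t / n)).re - 1) := by simp
    rw [h2]
    exact mul_nonpos_of_nonneg_of_nonpos hn0.le (by linarith)
  have hFle : ∀ t, ‖F t‖ ≤ 1 / ‖Complex.exp (ψ t)‖ := fun t => by
    simp only [hF]
    rw [Complex.exp_sub, norm_div]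
    gcongr
    exact hcp t
  have hcont : Continuous fun s => 1 / ‖Complex.exp (ψ s)‖ :=
    continuous_const.div (by fun_prop) fun s => (hpos s).ne'
  have hbound := image_norm_le_of_norm_deriv_right_le_deriv_boundary
    (f := fun t => F t - 1) (a := 0) (b := T)
    (f' := fun t => F t * (d t * (Complex.exp (ψ t / n) - 1)))
    (B := fun t => M ^ 2 * T / n * ∫ s in (0 : ℝ)..t, 1 / ‖Complex.exp (ψ s)‖)
    (B' := fun t => M ^ 2 * T / n * (1 / ‖Complex.exp (ψ t)‖))
    (fun t _ => (hFd t).continuousAt.continuousWithinAt)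
    (fun t _ => (hFd t).hasDerivWithinAt) (by simp [hF, hψ0])
    (fun t => (hcont.integral_hasStrictDerivAt 0 t).hasDerivAt.const_mul _)
    (fun t ht => by
      have hz : ‖Complex.exp (ψ t / n) - 1‖ ≤ M * T / n := by
        refine (norm_exp_sub_one_le_of_re_nonpos (hre' t)).trans ?_
        rw [norm_div, Complex.norm_natCast]
        gcongr
        refine (hψ t).trans ?_
        rw [abs_of_nonneg ht.1]
        gcongr
        exact ht.2.le
      rw [norm_mul, norm_mul]
      calc ‖F t‖ * (‖d t‖ * ‖Complex.exp (ψ t / n) - 1‖)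
          ≤ 1 / ‖Complex.exp (ψ t)‖ * (M * (M * T / n)) := by
            gcongr
            · exact hFle t
            · exact hdM t
        _ = _ := by ring)
    (Set.right_mem_Icc.2 hT)
  have hfac : Complex.exp (n * (Complex.exp (ψ T / n) - 1)) - Complex.exp (ψ T)
      = Complex.exp (ψ T) * (F T - 1) := by
    simp only [hF]
    rw [mul_sub (Complex.exp (ψ T)), mul_one, ← Complex.exp_add, add_sub_cancel]
  rw [hfac, norm_mul, mul_left_comm]
  gcongr

end

lemma measureReal_map_Ioc_le_of_pdf_le {Ω : Type*} [MeasurableSpace Ω] {P : Measure Ω}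
    {X : Ω → ℝ} [HasPDF X P volume] {H : ℝ}
    (hX : ∀ᵐ x : ℝ, pdf X P volume x ≤ ENNReal.ofReal H) {x y : ℝ} (hxy : x ≤ y) :
    (P.map X).real (Set.Ioc x y) ≤ max H 0 * (y - x) := by
  have h0 : 0 ≤ max H 0 := le_max_right _ _
  refine ENNReal.toReal_le_of_le_ofReal (mul_nonneg h0 (sub_nonneg.2 hxy)) ?_
  rw [map_eq_setLIntegral_pdf X P volume measurableSet_Ioc]
  calc ∫⁻ z in Set.Ioc x y, pdf X P volume z
      ≤ ∫⁻ z in Set.Ioc x y, ENNReal.ofReal (max H 0) :=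
        lintegral_mono_ae (ae_restrict_of_ae (hX.mono fun z hz =>
          hz.trans (ENNReal.ofReal_le_ofReal (le_max_left _ _))))
    _ = ENNReal.ofReal (max H 0 * (y - x)) := by
        rw [setLIntegral_const, Real.volume_Ioc, ENNReal.ofReal_mul h0]

/-- Optimisation of a smoothing bound over the smoothing parameter. -/
lemma le_of_forall_smoothing_le {η a h p M : ℝ} {n : ℕ} (hn : n ≠ 0) (hp : 1 ≤ p) (hM : 0 ≤ M)
    (hh : 0 ≤ h)
    (H : ∀ σ : ℝ, 0 < σ → η ≤ a * (M ^ 2 / n) * σ ^ (-(p + 1)) + h * σ) :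
    η ≤ (a + h) * (1 / (n : ℝ)) ^ (1 / (p + 2)) * M ^ (2 / (p + 2)) := by
  have hn0 : (0 : ℝ) < n := by exact_mod_cast Nat.pos_of_ne_zero hn
  have hp2 : p + 2 ≠ 0 := by linarith
  rcases hM.eq_or_lt with rfl | hM
  · have hz : (2 / (p + 2)) ≠ 0 := div_ne_zero two_ne_zero hp2
    rw [Real.zero_rpow hz, mul_zero]
    refine le_of_forall_pos_le_add fun ε hε => ?_
    have := H (ε / (h + 1)) (by positivity)
    refine this.trans ?_
    have h1 : h * (ε / (h + 1)) ≤ ε := by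
      rw [mul_div_assoc', div_le_iff₀ (by positivity)]; nlinarith
    simpa using h1
  · set σ := (1 / (n : ℝ)) ^ (1 / (p + 2)) * M ^ (2 / (p + 2)) with hσ
    have hσ0 : 0 < σ := by positivity
    have hpow : σ ^ (p + 2) = M ^ 2 / n := by
      rw [hσ, Real.mul_rpow (by positivity) (by positivity), ← Real.rpow_mul (by positivity),
        ← Real.rpow_mul hM.le, div_mul_cancel₀ _ hp2, div_mul_cancel₀ _ hp2, Real.rpow_one,
        Real.rpow_two]
      ring
    have h1 : M ^ 2 / n * σ ^ (-(p + 1)) = σ := by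
      rw [← hpow, ← Real.rpow_add hσ0, show p + 2 + -(p + 1) = 1 by ring, Real.rpow_one]
    have := H σ hσ0
    rw [mul_assoc, h1] at this
    rw [mul_assoc, ← hσ, add_mul]
    exact this

/-- Quantitative compound Poisson approximation of an infinitely divisible characteristic
function. -/
lemma IsIDLaw.norm_charFun_compoundPoisson_sub_le {μ μ' : Measure ℝ} {b : ℝ} {ν : Measure ℝ}
    [IsProbabilityMeasure μ'] (h : IsIDLaw μ b 0 ν) (h1 : Integrable (fun u : ℝ => |u|) ν)
    {C p : ℝ} (hC : ∀ t : ℝ, ‖charFun μ t‖ * (∫ s in (0 : ℝ)..|t|, 1 / ‖charFun μ s‖)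
      ≤ C * |t| ^ p) {n : ℕ} (hn : n ≠ 0) {g : ℝ → ℂ} (hg : IsDistinguishedRoot (charFun μ) n g)
    (hμ' : ∀ t : ℝ, charFun μ' t = Complex.exp (n * (g t - 1))) (t : ℝ) :
    ‖charFun μ' t - charFun μ t‖ ≤ C * (levyFirstMoment b ν ^ 2 / n) * (|t| * |t| ^ p) := by
  have := h.isProbabilityMeasure
  wlog ht : 0 ≤ t generalizing t
  · have h2 := this (-t) (by linarith)
    rwa [charFun_neg, charFun_neg, ← map_sub, RCLike.norm_conj, abs_neg] at h2
  have hφ : charFun μ = fun t => Complex.exp (levyKhintchineExponent b 0 ν t) :=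
    funext h.charFun_eq
  have hν := h.isLevyMeasure
  have hre : ∀ t, (levyKhintchineExponent b 0 ν t).re ≤ 0 := fun t => by
    rw [← Real.exp_le_one_iff, ← Complex.norm_exp, ← h.charFun_eq]
    exact norm_charFun_le_one t
  have hroot := IsDistinguishedRoot.eq_exp_div (continuous_levyKhintchineExponent hν h1 b)
    (levyKhintchineExponent_zero b ν) hn (hφ ▸ hg)
  have hmain := norm_compoundPoisson_sub_le (levyFirstMoment_nonneg b ν)
    (exists_hasDerivAt_levyKhintchineExponent hν h1 b) (norm_levyKhintchineExponent_le hν h1 b)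
    hre hn ht
  simp only [← h.charFun_eq, ← hroot, ← hμ'] at hmain
  have hCt := hC t
  rw [abs_of_nonneg ht] at hCt ⊢
  calc _ ≤ _ := hmain
    _ ≤ levyFirstMoment b ν ^ 2 * t / n * (C * t ^ p) := by gcongr
    _ = _ := by ring

theorem theorem4p3 (C p H : ℝ) (hC : 0 < C) (hp : 1 ≤ p) :
    ∃ C' : ℝ, 0 < C' ∧
      ∀ (Ω : Type*) [MeasurableSpace Ω] (P : Measure Ω) [IsProbabilityMeasure P]
        (X : Ω → ℝ) (b : ℝ) (ν : Measure ℝ),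
        AEMeasurable X P →
        IsIDLaw (P.map X) b 0 ν →
        Integrable X P →
        IntegrableOn (fun u : ℝ => |u|) (Set.Icc (-1) 1) ν →
        (∀ t : ℝ, ‖charFun (P.map X) t‖ * (∫ s in (0 : ℝ)..|t|, 1 / ‖charFun (P.map X) s‖)
          ≤ C * |t| ^ p) →
        HasPDF X P volume →
        (∀ᵐ x : ℝ, pdf X P volume x ≤ ENNReal.ofReal H) →
        Integrable (fun u : ℝ => |u|) ν ∧
        ∀ (n : ℕ), 1 ≤ n →
          ∀ (Ω' : Type*) [MeasurableSpace Ω'] (P' : Measure Ω') [IsProbabilityMeasure P']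
            (Xn : Ω' → ℝ) (g : ℝ → ℂ),
            AEMeasurable Xn P' →
            IsDistinguishedRoot (charFun (P.map X)) n g →
            (∀ t : ℝ, charFun (P'.map Xn) t = Complex.exp (n * (g t - 1))) →
            kolmogorovDist (P'.map Xn) (P.map X)
              ≤ C' * (1 / (n : ℝ)) ^ (1 / (p + 2))
                * (|levyDrift b ν| + ∫ u, |u| ∂ν) ^ (2 / (p + 2)) := by

  set c := ∫ t : ℝ, |t| ^ p * Real.exp (-(1 / 2) * t ^ 2) with hc
  have hc0 : 0 ≤ c := integral_nonneg fun t => by positivity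
  have hH0 : 0 ≤ max H 0 := le_max_right _ _
  refine ⟨2 * (C / Real.pi * c) + 6 * max H 0 + 1, by positivity, ?_⟩
  intro Ω _ P _ X b ν hX hID hXint hνint hφ hpdf hH
  have hν1 : Integrable (fun u : ℝ => |u|) ν :=
    hID.integrable_abs_levyMeasure hνint ((integrable_map_measure (by fun_prop) hX).2 hXint)
  refine ⟨hν1, ?_⟩
  intro n hn Ω' _ P' _ Xn g hXn hg hchar
  have : IsProbabilityMeasure (P.map X) := Measure.isProbabilityMeasure_map hX
  have : IsProbabilityMeasure (P'.map Xn) := Measure.isProbabilityMeasure_map hXn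
  have hn' : n ≠ 0 := Nat.one_le_iff_ne_zero.1 hn
  have hopt := le_of_forall_smoothing_le (η := kolmogorovDist (P'.map Xn) (P.map X))
    (a := 2 * (C / Real.pi * c)) (h := 6 * max H 0) hn' hp (levyFirstMoment_nonneg b ν)
    (by positivity) fun σ hσ => by
      refine (kolmogorovDist_le_of_norm_charFun_sub_le _ _ (by linarith) hH0
        (hID.norm_charFun_compoundPoisson_sub_le hν1 hφ hn' hg hchar)
        (fun x y hxy => measureReal_map_Ioc_le_of_pdf_le hH hxy) hσ).trans (le_of_eq ?_)
      rw [← hc]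
      ring
  refine hopt.trans ?_
  change _ ≤ _ * _ * levyFirstMoment b ν ^ (2 / (p + 2))
  have := levyFirstMoment_nonneg b ν
  gcongr ?_ * _ * _
  linarith
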